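/- Theorem. A complete Boolean algebra $\mathbb{B}$ is called, for ordinals $\lambda,\mu$ (cardinals being identified with initial ordinals): - $(\lambda,\mu)$-distributive if for every family $\langle u_{\alpha,\beta}\in\mathbb{B} : \alpha<\lambda,\ \beta<\mu\rangle$ $$\prod_{\alpha<\lambda}\sum_{\beta<\mu}u_{\alpha,\beta}=\sum_{f:\lambda\to\mu}\ \prod_{\alpha<\lambda}u_{\alpha,f(\alpha)};$$ - weakly $(\lambda,\mu)$-distributive if for every such family $$\prod_{\alpha<\lambda}\sum_{\beta<\mu}u_{\alpha,\beta}=\sum_{g:\lambda\to\mu}\ \prod_{\alpha<\lambda}\ \sum_{\beta<g(\alpha)}u_{\alpha,\beta}.$$ For a cardinal $\kappa$, $\mathbb{B}$ is $\kappa$-c.c. if every antichain of $\mathbb{B}$ (a set of pairwise disjoint nonzero elements) has cardinality less than $\kappa$. A Suslin tree is a tree of height $\omega_1$ in which every branch (maximal chain) and every antichain (set of pairwise incomparable elements) is at most countable. Assume there are no Suslin trees. Let $\mathbb{B}$ be a complete Boolean algebra such that 1. $\mathbb{B}$ is $(\omega,|\mathbb{B}|)$-distributive, 2. $\mathbb{B}$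 is $\kappa$-c.c. for some cardinal $\kappa<\aleph_{\omega_1}$, and 3. for every uncountable cardinal $\kappa'<\kappa$, $\mathbb{B}$ is weakly $(|\mathbb{B}|^{\kappa'},\kappa')$-distributive. Then $\mathbb{B}$ is $(\omega_1,2)$-distributive. -/

import Mathlib

open Cardinal Ordinal

universe u

/-- The `(l, k)`-distributive law in a complete Boolean algebra `B`, for ordinals `l` and `k`. -/
def IsDistributiveBA (B : Type u) [CompleteBooleanAlgebra B] (l k : Ordinal.{u}) : Prop :=
  ∀ a : l.ToType → k.ToType → B,
    ⨅ i, ⨆ j, a i j = ⨆ f : l.ToType → k.ToType, ⨅ i, a i (f i)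

/-- The weak `(l, k)`-distributive law in a complete Boolean algebra `B`, for ordinals `l`
and `k`. -/
def IsWeaklyDistributiveBA (B : Type u) [CompleteBooleanAlgebra B] (l k : Ordinal.{u}) : Prop :=
  ∀ a : l.ToType → k.ToType → B,
    ⨅ i, ⨆ j, a i j = ⨆ g : l.ToType → k.ToType, ⨅ i, ⨆ j, ⨆ _ : j < g i, a i j

/-- `A` is an antichain of the Boolean algebra `B`: a set of pairwise disjoint nonzero elements. -/
def IsBooleanAntichain {B : Type u} [BooleanAlgebra B] (A : Set B) : Prop :=
  ⊥ ∉ A ∧ ∀ x ∈ A, ∀ y ∈ A, x ≠ y → x ⊓ y = ⊥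

/-- The `κ`-chain condition: every antichain of `B` has cardinality less than `κ`. -/
def SatisfiesCC (B : Type u) [BooleanAlgebra B] (κ : Cardinal.{u}) : Prop :=
  ∀ A : Set B, IsBooleanAntichain A → #A < κ

/-- A set-theoretic tree: a partial order in which the predecessors of each element are
well-ordered. -/
structure IsSetTree (T : Type u) [PartialOrder T] : Prop where
  isWellOrder_Iio : ∀ x : T, IsWellOrder (Set.Iio x) (· < ·)

/-- The level of `x` in a tree: the order type of the set of its predecessors. -/
noncomputable def IsSetTree.level {T : Type u} [PartialOrder T] (h : IsSetTree T) (x : T) :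
    Ordinal.{u} :=
  haveI := h.isWellOrder_Iio x
  Ordinal.type ((· < ·) : Set.Iio x → Set.Iio x → Prop)

/-- The height of a tree: the supremum of `level x + 1` over all `x`. -/
noncomputable def IsSetTree.height {T : Type u} [PartialOrder T] (h : IsSetTree T) :
    Ordinal.{u} :=
  ⨆ x : T, (h.level x + 1)

/-- A Suslin tree: a tree of height `ω₁` all of whose branches (maximal chains) and antichains
(sets of pairwise incomparable elements) are at most countable. -/
structure IsSuslinTree (T : Type u) [PartialOrder T] : Prop where
  isSetTree : IsSetTree T
  height_eq : isSetTree.height = ω₁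
  countable_of_branch : ∀ b : Set T, IsMaxChain (· ≤ ·) b → b.Countable
  countable_of_antichain : ∀ A : Set T, IsAntichain (· ≤ ·) A → A.Countable

/-! If `(ω₁, 2)`-distributivity fails, the two sides differ by a nonzero element. Weak
distributivity at `ℵ₁` (or `κ ≤ ℵ₁`) yields a nonzero `c` below it under which antichains are
countable (`exists_ccc_below`). Consistent decisions of the `ω₁` given elements below `c` form a
tree. Distributivity over `ω` keeps its levels nonempty, countable antichains below `c` keep its
antichains countable, and an uncountable branch would yield a nonzero meet of literals below `c`,
which the failure excludes. So the tree is Suslin. -/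

theorem exists_ccc_below {B : Type u} [CompleteBooleanAlgebra B] {κ : Cardinal.{u}}
    (hcc : SatisfiesCC B κ)
    (hweak : ∀ κ' : Cardinal.{u}, ℵ₀ < κ' → κ' < κ →
      IsWeaklyDistributiveBA B (#B ^ κ').ord κ'.ord)
    {p : B} (hp : p ≠ ⊥) :
    ∃ c ≤ p, c ≠ ⊥ ∧ ∀ A : Set B, IsBooleanAntichain A → (∀ x ∈ A, x ≤ c) → A.Countable := by
  rcases le_or_gt κ ℵ₁ with hκ | hκ
  · refine ⟨p, le_rfl, hp, fun A hA _ ↦ ?_⟩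
    rw [← Cardinal.le_aleph0_iff_set_countable, ← Order.lt_succ_iff, Cardinal.succ_aleph0]
    exact (hcc A hA).trans_le hκ
  have hw := hweak ℵ₁ Cardinal.aleph0_lt_aleph_one hκ
  have hJ : #(ℵ₁ : Cardinal.{u}).ord.ToType = ℵ₁ := by simp
  obtain ⟨e⟩ : Nonempty ((#B ^ (ℵ₁ : Cardinal.{u})).ord.ToType ≃
      ((ℵ₁ : Cardinal.{u}).ord.ToType → B)) := by
    rw [← Cardinal.eq, ← Cardinal.power_def, hJ]; simp
  have : Nonempty (ℵ₁ : Cardinal.{u}).ord.ToType := by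
    rw [← Cardinal.mk_ne_zero_iff, hJ]; exact (Cardinal.aleph_pos 1).ne'
  -- The rows run over all `ω₁`-sequences in `B`; joining the complement of its supremum makes each
  -- row cover `⊤`.
  have h := hw fun k j ↦ e k j ⊔ (⨆ i, e k i)ᶜ
  have htop : ⨅ k, ⨆ j, (e k j ⊔ (⨆ i, e k i)ᶜ) = ⊤ := by
    simp [← iSup_sup]
  rw [htop] at h
  obtain ⟨g, hg⟩ : ∃ g : (#B ^ (ℵ₁ : Cardinal.{u})).ord.ToType → (ℵ₁ : Cardinal.{u}).ord.ToType,
      p ⊓ ⨅ k, ⨆ j, ⨆ _ : j < g k, (e k j ⊔ (⨆ i, e k i)ᶜ) ≠ ⊥ := by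
    by_contra! hcon
    apply hp
    rw [← inf_top_eq p, h, inf_iSup_eq]
    simp [hcon]
  refine ⟨_, inf_le_left, hg, fun A hA hAc ↦ ?_⟩
  by_contra hunc
  rw [← Cardinal.le_aleph0_iff_set_countable, not_le, ← Order.succ_le_iff,
    Cardinal.succ_aleph0, ← hJ] at hunc
  obtain ⟨f⟩ := hunc
  set k := e.symm fun j ↦ (f j : B) with hk
  have hek : e k = fun j ↦ (f j : B) := by simp [hk]
  -- Member number `g k` is covered by the terms of index below `g k`, yet it is disjoint from each
  -- of them.
  have hle : (f (g k) : B) ≤ ⨆ j, ⨆ _ : j < g k, (e k j ⊔ (⨆ i, e k i)ᶜ) :=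
    (hAc _ (f (g k)).2).trans (inf_le_right.trans (iInf_le _ k))
  apply hA.1
  suffices (f (g k) : B) = ⊥ from this ▸ (f (g k)).2
  rw [← inf_eq_left.2 hle]
  simp only [inf_iSup_eq, iSup_eq_bot]
  intro j hj
  rw [inf_sup_left, hek, hA.2 _ (f (g k)).2 _ (f j).2 fun h ↦ hj.ne' (f.injective (Subtype.ext h)),
    bot_sup_eq, ← disjoint_iff, disjoint_compl_right_iff]
  exact le_iSup (fun j ↦ (f j : B)) (g k)

/-- The literal of `x i` selected by `S`: the element `x i` if `i ∈ S`, its complement otherwise. -/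
noncomputable def literal {B : Type u} [CompleteBooleanAlgebra B] {ι : Type u} (x : ι → B)
    (S : Set ι) (i : ι) : B :=
  open Classical in if i ∈ S then x i else (x i)ᶜ

theorem IsDistributiveBA.iSup_iInf_literal_eq_top {B : Type u} [CompleteBooleanAlgebra B]
    (hdist : IsDistributiveBA B ω (#B).ord) {ι : Type u} [Countable ι] (x : ι → B) :
    ⨆ S : Set ι, ⨅ i, literal x S i = ⊤ := by
  classical
  obtain ⟨e⟩ : Nonempty ((#B).ord.ToType ≃ B) := by rw [← Cardinal.eq]; simp
  obtain ⟨n⟩ : Nonempty (ι ↪ (ω : Ordinal.{u}).ToType) := by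
    rw [← Cardinal.le_def]; simp
  -- Row `n i` offers only `x i` and its complement; rows outside the range of `n` are constantly
  -- `⊤`.
  have h := hdist fun m b ↦
    if ∀ i, n i = m → e b = x i ∨ e b = (x i)ᶜ then (if ∃ i, n i = m then e b else ⊤) else ⊥
  rw [eq_top_iff]
  refine le_trans (le_of_eq ?_) (h.le.trans (iSup_le fun f ↦ ?_))
  · rw [eq_comm, iInf_eq_top]
    intro m
    by_cases hm : ∃ i, n i = m
    · obtain ⟨i, rfl⟩ := hm
      rw [eq_top_iff, ← sup_compl_eq_top (x := x i)]
      refine sup_le (le_iSup_of_le (e.symm (x i)) ?_) (le_iSup_of_le (e.symm (x i)ᶜ) ?_) <;>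
      simp
    · rw [eq_top_iff]
      refine le_iSup_of_le (e.symm ⊤) ?_
      rw [if_pos fun i hi ↦ (hm ⟨i, hi⟩).elim, if_neg hm]
  · refine le_iSup_of_le {i | e (f (n i)) = x i} (le_iInf fun i ↦ iInf_le_of_le (n i) ?_)
    simp only [literal, Set.mem_ofPred_eq, n.injective.eq_iff, forall_eq, exists_eq, if_true]
    split_ifs with h1 h2 h2
    · exact h2.le
    · exact (h1.resolve_left h2).le
    · exact bot_le
    · exact bot_le

/-! ### The tree of partial decisions -/

section Literal

variable {B : Type u} [CompleteBooleanAlgebra B] {ι : Type u} {x : ι → B} {S S' : Set ι}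

theorem literal_congr {i : ι} (h : i ∈ S ↔ i ∈ S') : literal x S i = literal x S' i := by
  by_cases hi : i ∈ S <;> simp [literal, hi, ← h]

theorem literal_inf_literal {i : ι} (h : ¬ (i ∈ S ↔ i ∈ S')) :
    literal x S i ⊓ literal x S' i = ⊥ := by
  by_cases h1 : i ∈ S <;> by_cases h2 : i ∈ S' <;> simp_all [literal]

variable [LinearOrder ι]

/-- The part of `c` on which all the literals with index below `i` selected by `S` hold. -/
noncomputable def nodeValue (x : ι → B) (c : B) (i : ι) (S : Set ι) : B :=
  c ⊓ ⨅ j : Set.Iio i, literal x S j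

theorem nodeValue_le (x : ι → B) (c : B) (i : ι) (S : Set ι) : nodeValue x c i S ≤ c :=
  inf_le_left

theorem nodeValue_le_literal (x : ι → B) (c : B) {i j : ι} (h : j < i) (S : Set ι) :
    nodeValue x c i S ≤ literal x S j :=
  inf_le_right.trans (iInf_le (fun j : Set.Iio i ↦ literal x S j) ⟨j, h⟩)

theorem le_nodeValue_iff {c : B} {i : ι} {b : B} :
    b ≤ nodeValue x c i S ↔ b ≤ c ∧ ∀ j < i, b ≤ literal x S j := by
  simp [nodeValue]

theorem nodeValue_anti {c : B} {i j : ι} (h : i ≤ j) :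
    nodeValue x c j S ≤ nodeValue x c i S :=
  le_nodeValue_iff.2 ⟨nodeValue_le .., fun _ hk ↦ nodeValue_le_literal _ _ (hk.trans_le h) _⟩

theorem nodeValue_congr {c : B} {i : ι} (h : ∀ j < i, j ∈ S ↔ j ∈ S') :
    nodeValue x c i S = nodeValue x c i S' := by
  unfold nodeValue
  congr 1
  exact iInf_congr fun j ↦ literal_congr (h j j.2)

/-- The tree of consistent partial decisions of the family `x` below `c`: pairs of an index `i`
and a subset `S` of the indices below `i` such that `nodeValue x c i S` is nonzero. -/
@[ext]
structure DecisionTree (x : ι → B) (c : B) : Type u where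
  index : ι
  decided : Set ι
  decided_subset : decided ⊆ Set.Iio index
  nodeValue_ne_bot : nodeValue x c index decided ≠ ⊥

namespace DecisionTree

variable {c : B}

instance : PartialOrder (DecisionTree x c) where
  le p q := p.index ≤ q.index ∧ p.decided = q.decided ∩ Set.Iio p.index
  le_refl p := ⟨le_rfl, (Set.inter_eq_left.2 p.decided_subset).symm⟩
  le_trans p q r hpq hqr := by
    refine ⟨hpq.1.trans hqr.1, ?_⟩
    rw [hpq.2, hqr.2, Set.inter_assoc, Set.inter_eq_right.2 (Set.Iio_subset_Iio hpq.1)]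
  le_antisymm p q hpq hqp := by
    have h := hpq.1.antisymm hqp.1
    refine DecisionTree.ext h ?_
    rw [hpq.2, h, Set.inter_eq_left.2 q.decided_subset]

theorem le_def {p q : DecisionTree x c} :
    p ≤ q ↔ p.index ≤ q.index ∧ p.decided = q.decided ∩ Set.Iio p.index :=
  Iff.rfl

theorem index_strictMono : StrictMono (index (x := x) (c := c)) := by
  intro p q h
  refine h.le.1.lt_of_ne fun he ↦ h.not_ge ⟨he.ge, ?_⟩
  rw [h.le.2, ← he, Set.inter_assoc, Set.inter_self, Set.inter_eq_left.2 (he ▸ q.decided_subset)]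

/-- The node at index `i` below a given node. -/
def restrict (p : DecisionTree x c) (i : ι) (h : i ≤ p.index) : DecisionTree x c :=
  ⟨i, p.decided ∩ Set.Iio i, Set.inter_subset_right, by
    rw [nodeValue_congr (S := p.decided ∩ Set.Iio i) (S' := p.decided) fun j hj ↦ and_iff_left hj]
    exact ne_bot_of_le_ne_bot p.nodeValue_ne_bot (nodeValue_anti h)⟩

/-- The predecessors of a node correspond to the indices below its index. -/
def predecessorsIso (p : DecisionTree x c) :
    ((· < ·) : Set.Iio p → Set.Iio p → Prop) ≃r
      ((· < ·) : Set.Iio p.index → Set.Iio p.index → Prop) where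
  toFun q := ⟨q.1.index, index_strictMono (Set.mem_Iio.1 q.2)⟩
  invFun i := ⟨restrict p i i.2.le,
    lt_of_le_of_ne (le_def.2 ⟨i.2.le, rfl⟩) fun h ↦ i.2.ne (congrArg index h)⟩
  left_inv q := Subtype.ext (DecisionTree.ext rfl (le_def.1 (Set.mem_Iio.1 q.2).le).2.symm)
  right_inv _ := rfl
  map_rel_iff' {q r} := by
    refine ⟨fun h ↦ lt_of_le_of_ne (le_def.2 ⟨le_of_lt h, ?_⟩) ?_, fun h ↦ index_strictMono h⟩
    · have h' : q.1.index ≤ r.1.index := le_of_lt h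
      rw [(le_def.1 (Set.mem_Iio.1 r.2).le).2, Set.inter_assoc,
        Set.inter_eq_right.2 (Set.Iio_subset_Iio h'), ← (le_def.1 (Set.mem_Iio.1 q.2).le).2]
    · rintro rfl
      exact lt_irrefl _ h

theorem isSetTree [WellFoundedLT ι] : IsSetTree (DecisionTree x c) where
  isWellOrder_Iio p := (predecessorsIso p).toRelEmbedding.isWellOrder

theorem level_eq [WellFoundedLT ι] (p : DecisionTree x c) :
    isSetTree.level p = Ordinal.typein (α := ι) (· < ·) p.index := by
  rw [← Ordinal.type_Iio_lt]
  have := isSetTree.isWellOrder_Iio p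
  exact (predecessorsIso p).ordinalType_congr

/-- Incomparable nodes disagree at an index below both, where their literals are complementary. -/
theorem nodeValue_inf_eq_bot {p q : DecisionTree x c} (hpq : ¬ p ≤ q) (hqp : ¬ q ≤ p) :
    nodeValue x c p.index p.decided ⊓ nodeValue x c q.index q.decided = ⊥ := by
  wlog h : p.index ≤ q.index generalizing p q
  · rw [inf_comm]
    exact this hqp hpq (le_of_not_ge h)
  obtain ⟨j, hj, hne⟩ : ∃ j < p.index, ¬ (j ∈ p.decided ↔ j ∈ q.decided) := by
    by_contra! hcon
    refine hpq ⟨h, Set.ext fun j ↦ ⟨fun hj ↦ ?_, fun hj ↦ (hcon j hj.2).2 hj.1⟩⟩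
    exact ⟨(hcon j (p.decided_subset hj)).1 hj, p.decided_subset hj⟩
  exact le_bot_iff.1 ((inf_le_inf (nodeValue_le_literal _ _ hj _)
    (nodeValue_le_literal _ _ (hj.trans_le h) _)).trans (literal_inf_literal hne).le)

end DecisionTree

end Literal

/-! ### Countability and the Suslin property -/

/-- If antichains below `c` are countable, so is any family of pairwise disjoint nonzero elements
below `c`. -/
theorem countable_of_inf_eq_bot {B : Type u} [BooleanAlgebra B] {c : B}
    (hc : ∀ A : Set B, IsBooleanAntichain A → (∀ x ∈ A, x ≤ c) → A.Countable)
    {α : Type*} {s : Set α} {v : α → B} (hle : ∀ i ∈ s, v i ≤ c) (hne : ∀ i ∈ s, v i ≠ ⊥)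
    (hd : ∀ i ∈ s, ∀ j ∈ s, i ≠ j → v i ⊓ v j = ⊥) : s.Countable := by
  have hinj : Set.InjOn v s := by
    intro i hi j hj h
    by_contra hij
    exact hne i hi (by simpa [h] using hd i hi j hj hij)
  refine Set.countable_of_injective_of_countable_image hinj (hc _ ⟨?_, ?_⟩ ?_)
  · rintro ⟨i, hi, h⟩
    exact hne i hi h
  · rintro _ ⟨i, hi, rfl⟩ _ ⟨j, hj, rfl⟩ h
    exact hd i hi j hj fun hij ↦ h (hij ▸ rfl)
  · rintro _ ⟨i, hi, rfl⟩
    exact hle i hi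

theorem countable_Iio_toType_omega_one (i : (ω₁ : Ordinal.{u}).ToType) :
    (Set.Iio i).Countable := by
  rw [← Cardinal.le_aleph0_iff_set_countable, ← Order.lt_succ_iff, Cardinal.succ_aleph0,
    ← Ordinal.card_type (α := Set.Iio i) (· < ·), ← Cardinal.lt_ord, Cardinal.ord_aleph,
    Ordinal.type_Iio_lt]
  exact Ordinal.typein_lt_self i

theorem exists_gt_of_countable {s : Set (ω₁ : Ordinal.{u}).ToType} (hs : s.Countable) :
    ∃ i, ∀ j ∈ s, j < i := by
  have h : (⋃ j ∈ s, Set.Iic j).Countable := hs.biUnion fun j _ ↦ by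
    rw [← Set.Iio_insert]
    exact (countable_Iio_toType_omega_one j).insert j
  obtain ⟨i, hi⟩ : ∃ i, i ∉ ⋃ j ∈ s, Set.Iic j := by
    by_contra! hcon
    rw [Set.eq_univ_of_forall hcon, ← Cardinal.le_aleph0_iff_set_countable, Cardinal.mk_univ,
      Cardinal.mk_toType, ← Cardinal.ord_aleph, Cardinal.card_ord] at h
    exact h.not_gt Cardinal.aleph0_lt_aleph_one
  exact ⟨i, by simpa using hi⟩

/-- If antichains below `c` are countable, a decreasing sequence of node values of length `ω₁`
becomes constant, so it is eventually zero as soon as its meet is. -/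
theorem exists_nodeValue_eq_bot {B : Type u} [CompleteBooleanAlgebra B] {c : B}
    (hc : ∀ A : Set B, IsBooleanAntichain A → (∀ x ∈ A, x ≤ c) → A.Countable)
    {x : (ω₁ : Ordinal.{u}).ToType → B} {S : Set (ω₁ : Ordinal.{u}).ToType}
    (hS : c ⊓ ⨅ i, literal x S i = ⊥) : ∃ i, nodeValue x c i S = ⊥ := by
  -- The pieces lost at successive indices are pairwise disjoint, so only countably many are
  -- nonzero.
  have hcount : {i | nodeValue x c i S ⊓ (literal x S i)ᶜ ≠ ⊥}.Countable := by
    refine countable_of_inf_eq_bot hc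
      (fun i _ ↦ inf_le_left.trans (nodeValue_le x c i S)) (fun _ h ↦ h) fun i _ j _ hij ↦ ?_
    wlog h : i < j generalizing i j
    · rw [inf_comm]
      exact this j ‹_› i ‹_› hij.symm (hij.symm.lt_of_le (not_lt.1 h))
    rw [← le_bot_iff, ← compl_inf_self (literal x S i)]
    exact inf_le_inf inf_le_right (inf_le_left.trans (nodeValue_le_literal _ _ h _))
  obtain ⟨i, hi⟩ := exists_gt_of_countable hcount
  refine ⟨i, ?_⟩
  rw [← le_bot_iff, ← hS]
  refine le_inf (nodeValue_le ..) (le_iInf fun j ↦ ?_)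
  induction j using WellFoundedLT.induction with
  | ind j ih =>
  rcases lt_or_ge j i with h | h
  · exact nodeValue_le_literal _ _ h _
  · have hj : nodeValue x c j S ⊓ (literal x S j)ᶜ = ⊥ := by
      by_contra hcon
      exact (hi j hcon).not_ge h
    rw [← disjoint_iff, disjoint_compl_right_iff] at hj
    exact (le_nodeValue_iff.2 ⟨nodeValue_le .., ih⟩).trans hj

/-- `hlevel` populates every level below `ω₁`; `hS` rules out uncountable branches. -/
theorem DecisionTree.isSuslinTree {B : Type u} [CompleteBooleanAlgebra B] {c : B} (hc0 : c ≠ ⊥)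
    (hc : ∀ A : Set B, IsBooleanAntichain A → (∀ x ∈ A, x ≤ c) → A.Countable)
    {x : (ω₁ : Ordinal.{u}).ToType → B}
    (hlevel : ∀ i, ⨆ S : Set (Set.Iio i), ⨅ j, literal (fun j : Set.Iio i ↦ x j.1) S j = ⊤)
    (hS : ∀ S, c ⊓ ⨅ i, literal x S i = ⊥) : IsSuslinTree (DecisionTree x c) where
  isSetTree := isSetTree
  height_eq := by
    refine le_antisymm (Ordinal.iSup_le fun p ↦ ?_) (le_of_forall_lt fun o ho ↦ ?_)
    · rw [level_eq, ← Order.succ_eq_add_one, Order.succ_le_iff]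
      exact Ordinal.typein_lt_self _
    · obtain ⟨i, rfl⟩ := Ordinal.typein_surj (α := (ω₁ : Ordinal.{u}).ToType) (· < ·)
        (by rwa [Ordinal.type_toType])
      obtain ⟨S, hSi⟩ : ∃ S : Set (Set.Iio i),
          c ⊓ ⨅ j, literal (fun j : Set.Iio i ↦ x j.1) S j ≠ ⊥ := by
        by_contra! hcon
        apply hc0
        rw [← inf_top_eq c, ← hlevel i, inf_iSup_eq]
        simp [hcon]
      have hv : nodeValue x c i (Subtype.val '' S) ≠ ⊥ := by
        convert hSi using 2
        refine congrArg _ (iInf_congr fun j ↦ ?_)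
        have h : j.1 ∈ Subtype.val '' S ↔ j ∈ S := Subtype.val_injective.mem_set_image
        by_cases hj : j ∈ S <;> simp only [literal, h, hj, if_true, if_false]
      let p : DecisionTree x c := ⟨i, Subtype.val '' S, by rintro _ ⟨j, _, rfl⟩; exact j.2, hv⟩
      refine lt_of_lt_of_le ?_ (Ordinal.le_iSup _ p)
      rw [level_eq, ← Order.succ_eq_add_one]
      exact Order.lt_succ _
  countable_of_antichain A hA := by
    refine countable_of_inf_eq_bot hc (v := fun p : DecisionTree x c ↦ nodeValue x c p.index p.decided)
      (fun p _ ↦ nodeValue_le ..) (fun p _ ↦ p.nodeValue_ne_bot) fun p hp q hq hpq ↦ ?_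
    exact nodeValue_inf_eq_bot (hA hp hq hpq) (hA hq hp hpq.symm)
  countable_of_branch b hb := by
    by_contra hunc
    have hinj : Set.InjOn (index (x := x) (c := c)) b := by
      intro p hp q hq h
      by_contra hpq
      rcases hb.1 hp hq hpq with h' | h'
      · exact (index_strictMono (h'.lt_of_ne hpq)).ne h
      · exact (index_strictMono (h'.lt_of_ne' hpq)).ne' h
    have hunb (i) : ∃ p ∈ b, i ≤ p.index := by
      by_contra! hcon
      refine hunc (Set.countable_of_injective_of_countable_image hinj
        ((countable_Iio_toType_omega_one i).mono ?_))
      rintro _ ⟨p, hp, rfl⟩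
      exact hcon p hp
    -- The union of the decisions along `b` agrees with each node of `b` below that node's index.
    obtain ⟨i, hi⟩ := exists_nodeValue_eq_bot hc (hS (⋃ p ∈ b, p.decided))
    obtain ⟨p, hp, hip⟩ := hunb i
    refine p.nodeValue_ne_bot (le_bot_iff.1 (hi ▸ (nodeValue_anti hip).trans (nodeValue_congr ?_).le))
    intro j hj
    refine ⟨fun h ↦ Set.mem_biUnion hp h, fun h ↦ ?_⟩
    obtain ⟨q, hq, hjq⟩ := Set.mem_iUnion₂.1 h
    rcases hb.1.total hp hq with h' | h'
    · rw [h'.2]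
      exact ⟨hjq, hj.trans_le hip⟩
    · rw [h'.2] at hjq
      exact hjq.1

theorem mainTheorem3
    (noSuslin : ¬ ∃ (T : Type u) (_ : PartialOrder T), IsSuslinTree T)
    (B : Type u) [CompleteBooleanAlgebra B]
    (hdist : IsDistributiveBA B ω (#B).ord)
    (κ : Cardinal.{u}) (hκ : κ < ℵ_ ω₁)
    (hcc : SatisfiesCC B κ)
    (hweak : ∀ κ' : Cardinal.{u}, ℵ₀ < κ' → κ' < κ →
      IsWeaklyDistributiveBA B (#B ^ κ').ord κ'.ord) :
    IsDistributiveBA B ω₁ 2 := by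
  classical
  intro a
  refine le_antisymm ?_ (iSup_le fun f ↦ iInf_mono fun i ↦ le_iSup (a i) (f i))
  by_contra hnle
  obtain ⟨c, hcp, hc0, hc⟩ := exists_ccc_below hcc hweak (mt sdiff_eq_bot_iff.1 hnle)
  obtain ⟨z, o, -, hzo⟩ := Cardinal.mk_eq_two_iff.1
    (show #(2 : Ordinal.{u}).ToType = 2 by simp)
  refine noSuslin ⟨DecisionTree (fun i ↦ a i z) c, inferInstance,
    DecisionTree.isSuslinTree hc0 hc (fun i ↦ ?_) fun S ↦ ?_⟩
  · have := (countable_Iio_toType_omega_one i).to_subtype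
    exact hdist.iSup_iInf_literal_eq_top _
  · rw [← le_bot_iff, ← inf_sdiff_self_right 
      (x := ⨆ f : (ω₁ : Ordinal.{u}).ToType → (2 : Ordinal.{u}).ToType, ⨅ i, a i (f i))]
    -- Since `c ≤ a i z ⊔ a i o`, the complement of `a i z` lies under `a i o` below `c`, so
    -- deciding column `z` alone determines a choice function.
    refine le_inf (le_iSup_of_le (fun i ↦ if i ∈ S then z else o) (le_iInf fun i ↦ ?_))
      (inf_le_left.trans hcp)
    refine (inf_le_inf_left c (iInf_le _ i)).trans ?_
    by_cases hi : i ∈ S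
    · simp [literal, hi]
    · have h : c ≤ a i z ⊔ a i o := by
        refine (hcp.trans sdiff_le).trans ((iInf_le _ i).trans (iSup_le fun j ↦ ?_))
        rcases hzo.ge (Set.mem_univ j) with rfl | rfl
        · exact le_sup_left
        · exact le_sup_right
      simp only [literal, hi, if_false]
      rw [← sdiff_eq]
      exact sdiff_le_iff.2 h
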